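/- Let $m\ge 1$ and let $\mathfrak g=\bigoplus_{i\in\mathbb Z/m}\mathfrak g_i$ be a finite-dimensional real $\mathbb Z/m$-graded semisimple Lie algebra, with complexification $\mathfrak g^{\mathbb C}=\bigoplus_i\mathfrak g_i^{\mathbb C}$. Let $\tau_{\mathfrak g}$ be the complex conjugation of $\mathfrak g^{\mathbb C}$ with respect to $\mathfrak g$, and let $\theta^{\mathbb C}$ be the automorphism of $\mathfrak g^{\mathbb C}$ acting on $\mathfrak g_k^{\mathbb C}$ as multiplication by $e^{2\pi\sqrt{-1}\,k/m}$. Let $\mathfrak u$ be a compact real form of $\mathfrak g^{\mathbb C}$ whose complex conjugation $\tau_{\mathfrak u}$ commutes with $\tau_{\mathfrak g}$; the restriction of $\tau_{\mathfrak u}$ to $\mathfrak g$ is a Cartan involution of $\mathfrak g$, again denoted $\tau_{\mathfrak u}$. Assume that $\tau_{\mathfrak u}$ is R-compatible with the gradation, that is, $\tau_{\mathfrak u}\theta^{\mathbb C}=\theta^{\mathbb C}\tau_{\mathfrak u}$ on $\mathfrak g^{\mathbb C}$. Let $\tau_{\mathfrak u}^{\mathbb C}$ be the $\mathbb C$-linear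 extension to $\mathfrak g^{\mathbb C}$ of $\tau_{\mathfrak u}:\mathfrak g\to\mathfrak g$. Let $G_0$ (resp. $G_0^{\mathbb C}$) be the connected Lie subgroup with Lie algebra $\mathfrak g_0$ (resp. $\mathfrak g_0^{\mathbb C}$) of a connected Lie group with Lie algebra $\mathfrak g$ (resp. $\mathfrak g^{\mathbb C}$); thus $Ad_{G_0}$ (resp. $Ad_{G_0^{\mathbb C}}$) is the group of linear transformations of $\mathfrak g$ (resp. $\mathfrak g^{\mathbb C}$) generated by all $e^{\mathrm{ad}\,x}$ with $x\in\mathfrak g_0$ (resp. $x\in\mathfrak g_0^{\mathbb C}$). Then for every $i\in\mathbb Z/m$: 1. $\tau_{\mathfrak u}$ maps $\mathfrak g_i$ bijectively onto $\mathfrak g_{-i}$, $\tau_{\mathfrak u}(Ad_{G_0}e)=Ad_{G_0}(\tau_{\mathfrak u}e)$ for every $e\in\mathfrak g_i$, and $O\mapsto\tau_{\mathfrak u}(O)$ is a bijection from the set of $Ad_{G_0}$-orbits in $\mathfrak g_i$ onto the set of $Ad_{G_0}$-orbits in $\mathfrak g_{-i}$. 2. $\tau_{\mathfrak u}^{\mathbb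 C}=\tau_{\mathfrak u}\circ\tau_{\mathfrak g}$ on $\mathfrak g^{\mathbb C}$, $\tau_{\mathfrak u}^{\mathbb C}$ maps $\mathfrak g_i^{\mathbb C}$ bijectively onto $\mathfrak g_{-i}^{\mathbb C}$, $\tau_{\mathfrak u}^{\mathbb C}(Ad_{G_0^{\mathbb C}}e)=Ad_{G_0^{\mathbb C}}(\tau_{\mathfrak u}^{\mathbb C}e)$ for every $e\in\mathfrak g_i^{\mathbb C}$, and $O\mapsto\tau_{\mathfrak u}^{\mathbb C}(O)$ is a bijection from the set of $Ad_{G_0^{\mathbb C}}$-orbits in $\mathfrak g_i^{\mathbb C}$ onto the set of $Ad_{G_0^{\mathbb C}}$-orbits in $\mathfrak g_{-i}^{\mathbb C}$. -/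

import Mathlib

open scoped TensorProduct

noncomputable section

namespace GradedLie

/-! ### Exponentials and adjoint orbits -/

section Exponential

variable {K : Type*} [NontriviallyNormedField K]

/-- The exponential `exp T = ∑ Tⁿ / n!` of an endomorphism `T` of a finite-dimensional vector space
`V`; the series is summed in the canonical topology of the finite-dimensional algebra `End V`. -/
def endExp {V : Type*} [AddCommGroup V] [Module K V] [FiniteDimensional K V]
    (T : Module.End K V) : Module.End K V :=
  letI : TopologicalSpace (Module.End K V) := moduleTopology K (Module.End K V)
  haveI : IsModuleTopology K (Module.End K V) := ⟨rfl⟩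
  haveI : IsTopologicalRing (Module.End K V) := IsModuleTopology.isTopologicalRing K _
  NormedSpace.exp T

variable {L : Type*} [LieRing L] [LieAlgebra K L] [FiniteDimensional K L]

/-- For a subalgebra `h` of a finite-dimensional Lie algebra `L`, the group `Ad_H` of linear
transformations of `L`, where `H` is the connected Lie subgroup with Lie algebra `h` of any
connected Lie group with Lie algebra `L`. Since `H` is generated by `exp h` and
`Ad (exp x) = exp (ad x)`, this is the subgroup of `GL(L)` generated by all `exp (ad x)`,
`x ∈ h`. -/
def adGroup (h : Submodule K L) : Subgroup (L ≃ₗ[K] L) :=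
  Subgroup.closure
    {S : L ≃ₗ[K] L | ∃ x ∈ h, (S : Module.End K L) = endExp (LieAlgebra.ad K L x)}

/-- The orbit `Ad_H (e)` of a point `e ∈ L`. -/
def adOrbit (h : Submodule K L) (e : L) : Set L :=
  {y | ∃ S ∈ adGroup h, S e = y}

/-- The set of all `Ad_H`-orbits of the elements of a subspace `W` of `L`. -/
def adOrbits (h W : Submodule K L) : Set (Set L) :=
  {O | ∃ e ∈ W, O = adOrbit h e}

end Exponential

/-! ### The complexification and its real forms -/

section RealForms

variable (g : Type*) [LieRing g] [LieAlgebra ℝ g]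

/-- The complex conjugation `τ_g` of the complexification `g^ℂ = ℂ ⊗ g` with respect to the real
form `g`, that is, `c ⊗ x ↦ conj c ⊗ x`. -/
def tauG : (ℂ ⊗[ℝ] g) →ₗ[ℝ] (ℂ ⊗[ℝ] g) :=
  LinearMap.rTensor g Complex.conjAe.toLinearMap

/-- Multiplication by `√-1` on `g^ℂ`, as a real linear map. -/
def mulI : (ℂ ⊗[ℝ] g) →ₗ[ℝ] (ℂ ⊗[ℝ] g) :=
  (LinearMap.lsmul ℂ (ℂ ⊗[ℝ] g) Complex.I).restrictScalars ℝ

variable {g}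

/-- A real Lie subalgebra `u` of `g^ℂ` is a real form if `g^ℂ = u ⊕ √-1 u` as real vector spaces. -/
def IsRealForm (u : LieSubalgebra ℝ (ℂ ⊗[ℝ] g)) : Prop :=
  IsCompl u.toSubmodule (u.toSubmodule.map (mulI g))

/-- The complex conjugation `x + √-1 y ↦ x - √-1 y` (`x, y ∈ u`) of `g^ℂ` with respect to a real
form `u`. -/
def conjugation {u : LieSubalgebra ℝ (ℂ ⊗[ℝ] g)} (hu : IsRealForm u) :
    (ℂ ⊗[ℝ] g) →ₗ[ℝ] (ℂ ⊗[ℝ] g) :=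
  Submodule.projection _ _ hu - Submodule.projection _ _ hu.symm

theorem conjugation_apply {u : LieSubalgebra ℝ (ℂ ⊗[ℝ] g)} (hu : IsRealForm u)
    {x y : ℂ ⊗[ℝ] g} (hx : x ∈ u) (hy : y ∈ u) :
    conjugation hu (x + Complex.I • y) = x - Complex.I • y := by
  have hy' : Complex.I • y ∈ u.toSubmodule.map (mulI g) := ⟨y, hy, rfl⟩
  have hx' : x ∈ u.toSubmodule := hx
  have e1 : Submodule.projection _ _ hu (Complex.I • y) = 0 :=
    Submodule.projection_apply_right hu ⟨_, hy'⟩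
  have e2 : Submodule.projection _ _ hu.symm x = 0 :=
    Submodule.projection_apply_right hu.symm ⟨_, hx'⟩
  simp [conjugation, e1, e2, Submodule.projection_apply_of_mem_left hu hx',
    Submodule.projection_apply_of_mem_left hu.symm hy']

/-- A real form `u` is compact if its Killing form is negative definite. -/
def IsCompactRealForm (u : LieSubalgebra ℝ (ℂ ⊗[ℝ] g)) : Prop :=
  IsRealForm u ∧ ∀ x : u, x ≠ 0 → killingForm ℝ u x x < 0

end RealForms

/-! ### Cartan involutions -/

section Cartan

variable (g : Type*) [LieRing g] [LieAlgebra ℝ g]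

/-- The data of a Cartan involution `τ_u` of `g`: a compact real form `u` of `g^ℂ` which is
compatible with `g`, that is, `τ_g τ_u = τ_u τ_g`. -/
structure CartanInvolution where
  /-- the compact real form -/
  u : LieSubalgebra ℝ (ℂ ⊗[ℝ] g)
  isCompactRealForm : IsCompactRealForm u
  compatible : tauG g ∘ₗ conjugation isCompactRealForm.1 =
    conjugation isCompactRealForm.1 ∘ₗ tauG g

/-- The real part `c ⊗ x ↦ Re c • x`, a left inverse of the inclusion `x ↦ 1 ⊗ x` of `g`. -/
def rePart : (ℂ ⊗[ℝ] g) →ₗ[ℝ] g :=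
  (TensorProduct.lid ℝ g).toLinearMap ∘ₗ LinearMap.rTensor g Complex.reLm

theorem one_tmul_rePart {z : ℂ ⊗[ℝ] g} (hz : tauG g z = z) :
    (1 : ℂ) ⊗ₜ[ℝ] rePart g z = z := by
  have key : ∀ w : ℂ ⊗[ℝ] g, w + tauG g w = (2 : ℝ) • (1 : ℂ) ⊗ₜ[ℝ] rePart g w := by
    intro w
    induction w using TensorProduct.induction_on with
    | zero => simp
    | tmul a x =>
      have h : a + (starRingEnd ℂ) a = (2 * a.re : ℝ) • (1 : ℂ) := by
        apply Complex.ext <;> simp; ring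
      have h' : tauG g (a ⊗ₜ[ℝ] x) = (starRingEnd ℂ) a ⊗ₜ[ℝ] x := rfl
      have h2 : rePart g (a ⊗ₜ[ℝ] x) = a.re • x := rfl
      rw [h', h2, ← TensorProduct.add_tmul, h, TensorProduct.smul_tmul, TensorProduct.tmul_smul,
        TensorProduct.tmul_smul, smul_smul]
    | add a b ha hb =>
      rw [map_add, map_add, TensorProduct.tmul_add, smul_add, ← ha, ← hb]
      abel
  have h := key z
  rw [hz, ← two_smul ℝ] at h
  exact (smul_right_injective _ (two_ne_zero : (2 : ℝ) ≠ 0) h).symm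

namespace CartanInvolution

variable {g} (c : CartanInvolution g)

/-- The conjugation `τ_u` of `g^ℂ`. -/
def conj : (ℂ ⊗[ℝ] g) →ₗ[ℝ] (ℂ ⊗[ℝ] g) :=
  conjugation c.isCompactRealForm.1

/-- The Cartan involution `τ_u : g → g`: the restriction to `g` of the conjugation `τ_u` of `g^ℂ`.
The latter maps `g` to itself because it commutes with `τ_g`, see
`CartanInvolution.one_tmul_tau`. -/
def tau : g →ₗ[ℝ] g :=
  rePart g ∘ₗ c.conj ∘ₗ TensorProduct.mk ℝ ℂ g 1

theorem one_tmul_tau (x : g) : (1 : ℂ) ⊗ₜ[ℝ] c.tau x = c.conj ((1 : ℂ) ⊗ₜ[ℝ] x) := by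
  apply one_tmul_rePart
  have h := LinearMap.congr_fun c.compatible ((1 : ℂ) ⊗ₜ[ℝ] x)
  simp only [LinearMap.comp_apply] at h
  have h1 : tauG g ((1 : ℂ) ⊗ₜ[ℝ] x) = (1 : ℂ) ⊗ₜ[ℝ] x := by simp [tauG]
  rw [h1] at h
  exact h

/-- The `ℂ`-linear extension `τ_u^ℂ : g^ℂ → g^ℂ` of the Cartan involution `τ_u : g → g`. -/
def tauC : (ℂ ⊗[ℝ] g) →ₗ[ℂ] (ℂ ⊗[ℝ] g) :=
  c.tau.baseChange ℂ

end CartanInvolution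

end Cartan

/-! ### Gradations -/

section Gradation

variable {g : Type*} [LieRing g] [LieAlgebra ℝ g] {m : ℕ} [NeZero m]

/-- The automorphism `θ^ℂ` of `g^ℂ` associated with the `ℤ/m`-gradation: multiplication by
`exp (2π√-1 k / m)` on `g_k^ℂ`. It is the sum over `k` of these scalars times the `ℂ`-linear
extension of the projection of `g` onto `g_k`. -/
def thetaC (𝒜 : ZMod m → Submodule ℝ g) [GradedLieAlgebra 𝒜] :
    (ℂ ⊗[ℝ] g) →ₗ[ℂ] (ℂ ⊗[ℝ] g) :=
  ∑ k : ZMod m, Complex.exp (2 * Real.pi * Complex.I * (k.val : ℂ) / (m : ℂ)) •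
    ((𝒜 k).subtype ∘ₗ DirectSum.component ℝ (ZMod m) (fun j => 𝒜 j) k ∘ₗ
      (DirectSum.decomposeLinearEquiv 𝒜).toLinearMap).baseChange ℂ

theorem thetaC_apply (𝒜 : ZMod m → Submodule ℝ g) [GradedLieAlgebra 𝒜] (k : ZMod m)
    {z : ℂ ⊗[ℝ] g} (hz : z ∈ (𝒜 k).baseChange ℂ) :
    thetaC 𝒜 z = Complex.exp (2 * Real.pi * Complex.I * (k.val : ℂ) / (m : ℂ)) • z := by
  have hp : ∀ (j : ZMod m) (x : g), x ∈ 𝒜 k →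
      ((𝒜 j).subtype ∘ₗ DirectSum.component ℝ (ZMod m) (fun j => 𝒜 j) j ∘ₗ
      (DirectSum.decomposeLinearEquiv 𝒜).toLinearMap) x = if j = k then x else 0 := by
    intro j x hx
    have : ((DirectSum.decompose 𝒜 x) j : g) = if j = k then x else 0 := by
      split_ifs with h
      · subst h
        exact DirectSum.decompose_of_mem_same 𝒜 hx
      · exact DirectSum.decompose_of_mem_ne 𝒜 hx (Ne.symm h)
    exact this
  rw [Submodule.baseChange_eq_span] at hz
  induction hz using Submodule.span_induction with
  | mem z hz =>
    obtain ⟨x, hx, rfl⟩ := hz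
    rw [thetaC, LinearMap.sum_apply, Finset.sum_eq_single k]
    · simp [hp k x hx]
    · intro j _ hj
      simp [hp j x hx, hj]
    · simp
  | zero => simp
  | add a b _ _ ha hb => rw [map_add, ha, hb, smul_add]
  | smul r a _ ha => rw [map_smul, ha, smul_comm]

/-- A Cartan involution `τ_u` is R-compatible with the gradation if `u` is invariant under `θ^ℂ`,
in the form `τ_u θ^ℂ = θ^ℂ τ_u`. -/
def CartanInvolution.IsRCompatible (c : CartanInvolution g)
    (𝒜 : ZMod m → Submodule ℝ g) [GradedLieAlgebra 𝒜] : Prop :=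
  ∀ z : ℂ ⊗[ℝ] g, c.conj (thetaC 𝒜 z) = thetaC 𝒜 (c.conj z)

end Gradation

end GradedLie

end

/-!
The complexified components `g_k^ℂ` are the eigenspaces of `θ^ℂ` for the pairwise distinct
eigenvalues `exp (2π√-1 k / m)`. Since `τ_u` is antilinear and commutes with `θ^ℂ`, it takes the
eigenspace of `ζ` to that of `conj ζ`, hence `g_k^ℂ` to `g_{-k}^ℂ`, and `g_k` to `g_{-k}` because
`τ_u` preserves `g`. Both `τ_u` on `g` and its `ℂ`-linear extension are therefore automorphisms
preserving the degree-zero part, and an automorphism `φ` carries `Ad_H`-orbits to `Ad_{φ(H)}`-orbits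
because `φ ∘ exp (ad x) ∘ φ⁻¹ = exp (ad (φ x))`.
-/

namespace GradedLie

open Function Set

section Exponential

theorem t2Space_of_isModuleTopology (R M : Type*) [Ring R] [TopologicalSpace R]
    [IsTopologicalRing R] [T2Space R] [AddCommGroup M] [Module R M] [Module.Free R M]
    [TopologicalSpace M] [IsModuleTopology R M] : T2Space M := by
  let coords : M →ₗ[R] Module.Free.ChooseBasisIndex R M → R :=
    Finsupp.lcoeFun ∘ₗ (Module.Free.chooseBasis R M).repr.toLinearMap
  have hcoords : Injective coords := fun x y hxy =>
    (Module.Free.chooseBasis R M).repr.injective (DFunLike.coe_injective hxy)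
  exact .of_injective_continuous hcoords (IsModuleTopology.continuous_of_linearMap coords)

theorem map_exp_continuousAlgEquiv {𝕂 𝔸 𝔹 : Type*} [Field 𝕂] [CharZero 𝕂]
    [Ring 𝔸] [Algebra 𝕂 𝔸] [TopologicalSpace 𝔸] [IsTopologicalRing 𝔸]
    [Ring 𝔹] [Algebra 𝕂 𝔹] [TopologicalSpace 𝔹] [IsTopologicalRing 𝔹] [T2Space 𝔹]
    (e : 𝔸 ≃A[𝕂] 𝔹) (x : 𝔸) : e (NormedSpace.exp x) = NormedSpace.exp (e x) := by
  simp only [NormedSpace.exp_eq_tsum 𝕂, ← map_pow, ← map_smul]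
  exact LeftInverse.map_tsum _ e.continuous e.symm.continuous e.symm_apply_apply

variable {K : Type*} [NontriviallyNormedField K] [CharZero K]

theorem conj_endExp {V W : Type*} [AddCommGroup V] [Module K V] [FiniteDimensional K V]
    [AddCommGroup W] [Module K W] [FiniteDimensional K W] (φ : V ≃ₗ[K] W) (T : Module.End K V) :
    φ.conj (endExp T) = endExp (φ.conj T) := by
  let : TopologicalSpace (Module.End K V) := moduleTopology K _
  let : TopologicalSpace (Module.End K W) := moduleTopology K _
  have : IsModuleTopology K (Module.End K V) := ⟨rfl⟩
  have : IsModuleTopology K (Module.End K W) := ⟨rfl⟩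
  have : IsTopologicalRing (Module.End K V) := IsModuleTopology.isTopologicalRing K _
  have : IsTopologicalRing (Module.End K W) := IsModuleTopology.isTopologicalRing K _
  have : T2Space (Module.End K W) := t2Space_of_isModuleTopology K _
  let conjEquiv : Module.End K V ≃A[K] Module.End K W :=
    { φ.conjAlgEquiv K with
      continuous_toFun := IsModuleTopology.continuous_of_linearMap φ.conj.toLinearMap
      continuous_invFun := IsModuleTopology.continuous_of_linearMap φ.conj.symm.toLinearMap }
  exact map_exp_continuousAlgEquiv conjEquiv T

variable {L L' : Type*} [LieRing L] [LieAlgebra K L] [FiniteDimensional K L]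
  [LieRing L'] [LieAlgebra K L'] [FiniteDimensional K L']
  {h W : Submodule K L} {h' W' : Submodule K L'} (φ : L ≃ₗ⁅K⁆ L')

theorem conj_mem_adGroup (hφ : MapsTo φ h h') {S : L ≃ₗ[K] L} (hS : S ∈ adGroup h) :
    φ.toLinearEquiv.symm ≪≫ₗ S ≪≫ₗ φ.toLinearEquiv ∈ adGroup h' := by
  induction hS using Subgroup.closure_induction with
  | mem S hS =>
    obtain ⟨x, hx, hSx⟩ := hS
    refine Subgroup.subset_closure ⟨φ x, hφ hx, ?_⟩
    rw [← LieAlgebra.conj_ad_apply, ← conj_endExp, ← hSx]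
    rfl
  | one =>
    convert one_mem (adGroup h')
    ext y
    simp
  | mul S T _ _ hS hT =>
    convert mul_mem hS hT
    ext y
    exact congrArg (φ ∘ S) (φ.symm_apply_apply _).symm
  | inv S _ hS => exact inv_mem hS

theorem mapsTo_adOrbit (hφ : MapsTo φ h h') (e : L) :
    MapsTo φ (adOrbit h e) (adOrbit h' (φ e)) := by
  rintro _ ⟨S, hS, rfl⟩
  exact ⟨_, conj_mem_adGroup φ hφ hS, congrArg (φ ∘ S) (φ.symm_apply_apply e)⟩

theorem image_adOrbit (hφ : BijOn φ h h') (e : L) :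
    φ '' adOrbit h e = adOrbit h' (φ e) := by
  have hφ_symm : MapsTo φ.symm h' h := by
    intro y hy
    obtain ⟨x, hx, rfl⟩ := hφ.surjOn hy
    simpa using hx
  refine (mapsTo_adOrbit φ hφ.mapsTo e).image_subset.antisymm fun y hy => ?_
  refine ⟨φ.symm y, ?_, φ.apply_symm_apply y⟩
  simpa using mapsTo_adOrbit φ.symm hφ_symm (φ e) hy

theorem bijOn_image_adOrbits (hφ : BijOn φ h h') (hW : BijOn φ W W') :
    BijOn (fun O => φ '' O) (adOrbits h W) (adOrbits h' W') := by
  refine ⟨?_, φ.injective.image_injective.injOn, ?_⟩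
  · rintro _ ⟨e, he, rfl⟩
    exact ⟨φ e, hW.mapsTo he, image_adOrbit φ hφ e⟩
  · rintro _ ⟨_, he', rfl⟩
    obtain ⟨e, he, rfl⟩ := hW.surjOn he'
    exact ⟨adOrbit h e, ⟨e, he, rfl⟩, image_adOrbit φ hφ e⟩

end Exponential

section BaseChange

variable {R : Type*} (A : Type*) [CommRing R] [CommRing A] [Algebra R A]

theorem one_tmul_mem_baseChange_iff {M : Type*} [AddCommGroup M] [Module R M]
    [Module.FaithfullyFlat R A] {p : Submodule R M} {x : M} :
    (1 : A) ⊗ₜ[R] x ∈ p.baseChange A ↔ x ∈ p := by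
  rw [← Submodule.span_singleton_le_iff_mem x p, ← Submodule.baseChange_le_iff (A := A),
    Submodule.baseChange_span, image_singleton, Submodule.span_singleton_le_iff_mem]
  rfl

variable {M N : Type*} [AddCommGroup M] [Module R M] [AddCommGroup N] [Module R N]
  {p : Submodule R M} {q : Submodule R N}

theorem map_baseChange (f : M →ₗ[R] N) :
    (p.baseChange A).map (f.baseChange A) = (p.map f).baseChange A := by
  rw [Submodule.baseChange_eq_span, Submodule.baseChange_eq_span, Submodule.map_span]
  simp only [Submodule.map_coe, image_image, TensorProduct.mk_apply, LinearMap.baseChange_tmul]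

theorem baseChange_iSup {ι : Sort*} (p : ι → Submodule R M) :
    (⨆ k, p k).baseChange A = ⨆ k, (p k).baseChange A := by
  rw [Submodule.iSup_eq_span, Submodule.baseChange_span, image_iUnion, Submodule.span_iUnion]
  simp only [← Submodule.baseChange_span, Submodule.span_eq]

theorem bijOn_baseChange (e : M ≃ₗ[R] N) (he : BijOn e p q) :
    BijOn (e.toLinearMap.baseChange A) (p.baseChange A) (q.baseChange A) := by
  have hmap : p.map e.toLinearMap = q := SetLike.coe_injective he.image_eq
  rw [← hmap, ← map_baseChange]
  exact (e.baseChange R A M N).injective.injOn.bijOn_image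

variable {L L' : Type*} [LieRing L] [LieAlgebra R L] [LieRing L'] [LieAlgebra R L']

/-- The extension of scalars `A ⊗ L ≃ A ⊗ L'` of an isomorphism of Lie algebras. -/
def lieEquivBaseChange (e : L ≃ₗ⁅R⁆ L') : (A ⊗[R] L) ≃ₗ⁅A⁆ (A ⊗[R] L') :=
  { e.toLinearEquiv.baseChange R A L L' with
    map_lie' := fun {x y} => by
      change e.toLinearMap.baseChange A ⁅x, y⁆ =
        ⁅e.toLinearMap.baseChange A x, e.toLinearMap.baseChange A y⁆
      induction x using TensorProduct.induction_on with
      | zero => simp only [zero_lie, map_zero]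
      | add x x' hx hx' => simp only [add_lie, map_add, hx, hx']
      | tmul a x =>
        induction y using TensorProduct.induction_on with
        | zero => simp only [lie_zero, map_zero]
        | add y y' hy hy' => simp only [lie_add, map_add, hy, hy']
        | tmul b y =>
          simp only [LieAlgebra.ExtendScalars.bracket_tmul, LinearMap.baseChange_tmul]
          exact congrArg ((a * b) ⊗ₜ[R] ·) (e.map_lie x y) }

end BaseChange

theorem lie_add_smul_add_smul_of_mul_self_eq_neg_one {R L : Type*} [CommRing R] [LieRing L]
    [LieAlgebra R L] {a : R} (ha : a * a = -1) (x y x' y' : L) :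
    ⁅x + a • y, x' + a • y'⁆ = (⁅x, x'⁆ - ⁅y, y'⁆) + a • (⁅x, y'⁆ + ⁅y, x'⁆) := by
  simp only [add_lie, lie_add, smul_lie, lie_smul, smul_smul, ha, neg_one_smul, smul_add]
  abel

section RealForms

variable {g : Type*} [LieRing g] [LieAlgebra ℝ g] {u : LieSubalgebra ℝ (ℂ ⊗[ℝ] g)}
  (hu : IsRealForm u)

include hu in
theorem IsRealForm.exists_eq_add_I_smul (z : ℂ ⊗[ℝ] g) :
    ∃ x ∈ u, ∃ y ∈ u, z = x + Complex.I • y := by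
  have hz : z ∈ u.toSubmodule ⊔ u.toSubmodule.map (mulI g) := hu.sup_eq_top ▸ Submodule.mem_top
  obtain ⟨x, hx, _, ⟨y, hy, rfl⟩, rfl⟩ := Submodule.mem_sup.1 hz
  exact ⟨x, hx, y, hy, rfl⟩

theorem conjugation_involutive : Involutive (conjugation hu) := by
  intro z
  obtain ⟨x, hx, y, hy, rfl⟩ := hu.exists_eq_add_I_smul z
  rw [conjugation_apply hu hx hy, sub_eq_add_neg, ← smul_neg,
    conjugation_apply hu hx (neg_mem hy), smul_neg, sub_neg_eq_add]

theorem conjugation_I_smul (z : ℂ ⊗[ℝ] g) :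
    conjugation hu (Complex.I • z) = -(Complex.I • conjugation hu z) := by
  obtain ⟨x, hx, y, hy, rfl⟩ := hu.exists_eq_add_I_smul z
  have hI : Complex.I • (x + Complex.I • y) = -y + Complex.I • x := by
    rw [smul_add, smul_smul, Complex.I_mul_I, neg_one_smul, add_comm]
  rw [hI, conjugation_apply hu hx hy, conjugation_apply hu (neg_mem hy) hx, smul_sub, smul_smul,
    Complex.I_mul_I, neg_one_smul]
  abel

theorem conjugation_smul (a : ℂ) (z : ℂ ⊗[ℝ] g) :
    conjugation hu (a • z) = (starRingEnd ℂ) a • conjugation hu z := by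
  have smul_eq (b : ℂ) (w : ℂ ⊗[ℝ] g) : b • w = b.re • w + b.im • Complex.I • w := by
    rw [← algebraMap_smul ℂ b.re, ← algebraMap_smul ℂ b.im, smul_smul, ← add_smul]
    exact congrArg (· • w) (Complex.re_add_im b).symm
  rw [smul_eq a z, smul_eq _ (conjugation hu z), map_add, map_smul, map_smul, conjugation_I_smul]
  simp

theorem conjugation_lie (z w : ℂ ⊗[ℝ] g) :
    conjugation hu ⁅z, w⁆ = ⁅conjugation hu z, conjugation hu w⁆ := by
  obtain ⟨x, hx, y, hy, rfl⟩ := hu.exists_eq_add_I_smul z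
  obtain ⟨x', hx', y', hy', rfl⟩ := hu.exists_eq_add_I_smul w
  have hre : ⁅x, x'⁆ - ⁅y, y'⁆ ∈ u := sub_mem (u.lie_mem hx hx') (u.lie_mem hy hy')
  have him : ⁅x, y'⁆ + ⁅y, x'⁆ ∈ u := add_mem (u.lie_mem hx hy') (u.lie_mem hy hx')
  have hlie {a : ℂ} (ha : a * a = -1) : ⁅x + a • y, x' + a • y'⁆ =
      (⁅x, x'⁆ - ⁅y, y'⁆) + a • (⁅x, y'⁆ + ⁅y, x'⁆) :=
    lie_add_smul_add_smul_of_mul_self_eq_neg_one ha x y x' y'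
  have hI : -Complex.I * -Complex.I = -1 := by rw [neg_mul_neg, Complex.I_mul_I]
  rw [hlie Complex.I_mul_I, conjugation_apply hu hx hy, conjugation_apply hu hx' hy',
    conjugation_apply hu hre him]
  simpa only [neg_smul, ← sub_eq_add_neg] using (hlie hI).symm

variable {σ : g →ₗ[ℝ] g}

theorem baseChange_eq_conjugation_tauG
    (hσ : ∀ x, (1 : ℂ) ⊗ₜ[ℝ] σ x = conjugation hu ((1 : ℂ) ⊗ₜ[ℝ] x)) (z : ℂ ⊗[ℝ] g) :
    σ.baseChange ℂ z = conjugation hu (tauG g z) := by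
  induction z using TensorProduct.induction_on with
  | zero => simp
  | add a b ha hb => simp only [map_add, ha, hb]
  | tmul a x =>
    calc σ.baseChange ℂ (a ⊗ₜ x) = a • (1 : ℂ) ⊗ₜ[ℝ] σ x := by
          rw [LinearMap.baseChange_tmul, TensorProduct.smul_tmul', smul_eq_mul, mul_one]
      _ = conjugation hu ((starRingEnd ℂ) a • (1 : ℂ) ⊗ₜ[ℝ] x) := by
          rw [hσ, conjugation_smul, Complex.conj_conj]
      _ = conjugation hu (tauG g (a ⊗ₜ x)) := by
          rw [TensorProduct.smul_tmul', smul_eq_mul, mul_one]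
          rfl

theorem one_tmul_injective : Injective fun x : g => (1 : ℂ) ⊗ₜ[ℝ] x :=
  Module.FaithfullyFlat.tensorProduct_mk_injective g

/-- If the conjugation of `g^ℂ` with respect to a real form preserves `g`, its restriction `σ` to
`g` is an automorphism of the real Lie algebra `g`. -/
def restrictConjugation (hσ : ∀ x, (1 : ℂ) ⊗ₜ[ℝ] σ x = conjugation hu ((1 : ℂ) ⊗ₜ[ℝ] x)) :
    g ≃ₗ⁅ℝ⁆ g :=
  { LinearEquiv.ofInvolutive σ fun x => one_tmul_injective <| by
      simp only [hσ, conjugation_involutive hu _] with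
    map_lie' := fun {x y} => one_tmul_injective <| by
      have one_tmul_lie (x y : g) : (1 : ℂ) ⊗ₜ[ℝ] ⁅x, y⁆ = ⁅(1 : ℂ) ⊗ₜ[ℝ] x, (1 : ℂ) ⊗ₜ[ℝ] y⁆ := by
        rw [LieAlgebra.ExtendScalars.bracket_tmul, one_mul]
      change (1 : ℂ) ⊗ₜ[ℝ] σ ⁅x, y⁆ = (1 : ℂ) ⊗ₜ[ℝ] ⁅σ x, σ y⁆
      rw [hσ, one_tmul_lie, conjugation_lie, ← hσ, ← hσ, one_tmul_lie] }

end RealForms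

section Gradation

variable {g : Type*} [LieRing g] [LieAlgebra ℝ g] {m : ℕ} [NeZero m]
  (𝒜 : ZMod m → Submodule ℝ g) [GradedLieAlgebra 𝒜]

theorem thetaC_eigenspace (k : ZMod m) :
    Module.End.eigenspace (thetaC 𝒜) (ZMod.stdAddChar k) = (𝒜 k).baseChange ℂ := by
  have hle : (fun k => (𝒜 k).baseChange ℂ) ≤
      fun k => Module.End.eigenspace (thetaC 𝒜) (ZMod.stdAddChar k) := by
    intro k z hz
    rw [Module.End.mem_eigenspace_iff, thetaC_apply 𝒜 k hz, ZMod.stdAddChar_apply,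
      ZMod.toCircle_apply]
  have hindep : iSupIndep fun k : ZMod m =>
      Module.End.eigenspace (thetaC 𝒜) (ZMod.stdAddChar k) :=
    (Module.End.eigenspaces_iSupIndep (thetaC 𝒜)).comp ZMod.injective_stdAddChar
  have htop : ⨆ k, (𝒜 k).baseChange ℂ = ⊤ := by
    rw [← baseChange_iSup, (DirectSum.Decomposition.isInternal 𝒜).submodule_iSup_eq_top,
      Submodule.baseChange_top]
  exact (congrFun ((hindep.le_iff_eq_of_iSup_eq_top htop).1 hle) k).symm

variable {𝒜} {u : LieSubalgebra ℝ (ℂ ⊗[ℝ] g)} {hu : IsRealForm u}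
  (hR : ∀ z, conjugation hu (thetaC 𝒜 z) = thetaC 𝒜 (conjugation hu z))

include hR

theorem conjugation_mem_baseChange {k : ZMod m} {z : ℂ ⊗[ℝ] g} (hz : z ∈ (𝒜 k).baseChange ℂ) :
    conjugation hu z ∈ (𝒜 (-k)).baseChange ℂ := by
  rw [← thetaC_eigenspace, Module.End.mem_eigenspace_iff] at hz ⊢
  rw [← hR, hz, conjugation_smul, AddChar.map_neg_eq_conj]

theorem bijOn_restrictConjugation {σ : g →ₗ[ℝ] g}
    (hσ : ∀ x, (1 : ℂ) ⊗ₜ[ℝ] σ x = conjugation hu ((1 : ℂ) ⊗ₜ[ℝ] x)) (k : ZMod m) :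
    BijOn (restrictConjugation hu hσ) (𝒜 k) (𝒜 (-k)) := by
  have hmaps (k : ZMod m) : MapsTo σ (𝒜 k) (𝒜 (-k)) := by
    intro x hx
    rw [SetLike.mem_coe, ← one_tmul_mem_baseChange_iff ℂ] at hx ⊢
    rw [hσ]
    exact conjugation_mem_baseChange hR hx
  have hinv : LeftInverse σ σ := (restrictConjugation hu hσ).left_inv
  exact InvOn.bijOn ⟨hinv.leftInvOn _, hinv.leftInvOn _⟩ (hmaps k) (by simpa using hmaps (-k))

end Gradation

end GradedLie

open GradedLie in
theorem corollary3_general {g : Type*} [LieRing g] [LieAlgebra ℝ g] [FiniteDimensional ℝ g]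
    {m : ℕ} [NeZero m] (𝒜 : ZMod m → Submodule ℝ g) [GradedLieAlgebra 𝒜]
    {u : LieSubalgebra ℝ (ℂ ⊗[ℝ] g)} (hu : IsRealForm u)
    (hR : ∀ z, conjugation hu (thetaC 𝒜 z) = thetaC 𝒜 (conjugation hu z))
    {σ : g →ₗ[ℝ] g} (hσ : ∀ x, (1 : ℂ) ⊗ₜ[ℝ] σ x = conjugation hu ((1 : ℂ) ⊗ₜ[ℝ] x))
    (i : ZMod m) :
    (Set.BijOn σ (𝒜 i) (𝒜 (-i)) ∧
      (∀ e ∈ 𝒜 i, σ '' adOrbit (𝒜 0) e = adOrbit (𝒜 0) (σ e)) ∧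
      Set.BijOn (fun O => σ '' O) (adOrbits (𝒜 0) (𝒜 i)) (adOrbits (𝒜 0) (𝒜 (-i)))) ∧
    ((∀ z, σ.baseChange ℂ z = conjugation hu (tauG g z)) ∧
      Set.BijOn (σ.baseChange ℂ) ((𝒜 i).baseChange ℂ) ((𝒜 (-i)).baseChange ℂ) ∧
      (∀ e ∈ (𝒜 i).baseChange ℂ, σ.baseChange ℂ '' adOrbit ((𝒜 0).baseChange ℂ) e =
        adOrbit ((𝒜 0).baseChange ℂ) (σ.baseChange ℂ e)) ∧
      Set.BijOn (fun O => σ.baseChange ℂ '' O)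
        (adOrbits ((𝒜 0).baseChange ℂ) ((𝒜 i).baseChange ℂ))
        (adOrbits ((𝒜 0).baseChange ℂ) ((𝒜 (-i)).baseChange ℂ))) := by
  let φ : g ≃ₗ⁅ℝ⁆ g := restrictConjugation hu hσ
  let φC : (ℂ ⊗[ℝ] g) ≃ₗ⁅ℂ⁆ (ℂ ⊗[ℝ] g) := lieEquivBaseChange ℂ φ
  have hφ (k : ZMod m) : Set.BijOn φ (𝒜 k) (𝒜 (-k)) := bijOn_restrictConjugation hR hσ k
  have hφ₀ : Set.BijOn φ (𝒜 0) (𝒜 0) := by simpa only [neg_zero] using hφ 0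
  have hφC : Set.BijOn φC ((𝒜 i).baseChange ℂ) ((𝒜 (-i)).baseChange ℂ) :=
    bijOn_baseChange ℂ φ.toLinearEquiv (hφ i)
  have hφC₀ : Set.BijOn φC ((𝒜 0).baseChange ℂ) ((𝒜 0).baseChange ℂ) :=
    bijOn_baseChange ℂ φ.toLinearEquiv hφ₀
  exact ⟨⟨hφ i, fun e _ => image_adOrbit φ hφ₀ e, bijOn_image_adOrbits φ hφ₀ (hφ i)⟩,
    baseChange_eq_conjugation_tauG hu hσ, hφC, fun e _ => image_adOrbit φC hφC₀ e,
    bijOn_image_adOrbits φC hφC₀ hφC⟩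

theorem corollary3 {g : Type*} [LieRing g] [LieAlgebra ℝ g] [FiniteDimensional ℝ g]
    [LieAlgebra.IsSemisimple ℝ g] {m : ℕ} [NeZero m]
    (𝒜 : ZMod m → Submodule ℝ g) [GradedLieAlgebra 𝒜]
    (c : GradedLie.CartanInvolution g) (hc : c.IsRCompatible 𝒜) (i : ZMod m) :
    -- the real case
    (Set.BijOn c.tau (𝒜 i) (𝒜 (-i)) ∧
      (∀ e ∈ 𝒜 i, c.tau '' GradedLie.adOrbit (𝒜 0) e = GradedLie.adOrbit (𝒜 0) (c.tau e)) ∧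
      Set.BijOn (fun O => c.tau '' O)
        (GradedLie.adOrbits (𝒜 0) (𝒜 i)) (GradedLie.adOrbits (𝒜 0) (𝒜 (-i)))) ∧
    -- the complex case
    ((∀ z : TensorProduct ℝ ℂ g, c.tauC z = c.conj (GradedLie.tauG g z)) ∧
      Set.BijOn c.tauC ((𝒜 i).baseChange ℂ) ((𝒜 (-i)).baseChange ℂ) ∧
      (∀ e ∈ (𝒜 i).baseChange ℂ, c.tauC '' GradedLie.adOrbit ((𝒜 0).baseChange ℂ) e =
        GradedLie.adOrbit ((𝒜 0).baseChange ℂ) (c.tauC e)) ∧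
      Set.BijOn (fun O => c.tauC '' O)
        (GradedLie.adOrbits ((𝒜 0).baseChange ℂ) ((𝒜 i).baseChange ℂ))
        (GradedLie.adOrbits ((𝒜 0).baseChange ℂ) ((𝒜 (-i)).baseChange ℂ))) := by
  exact corollary3_general 𝒜 c.isCompactRealForm.1 hc c.one_tmul_tau i
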